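/- Assume GCH. Let $\mu$ be a regular (infinite) cardinal and $\lambda=\mu^+$. Let $S\subseteq\lambda$ be a stationary set of ordinals of cofinality $\mu$, and let $\bar\eta=\{\eta_\delta:\delta\in S\}$ be a ladder system on $S$, that is, each $\eta_\delta:\mu\to\delta$ is strictly increasing and cofinal in $\delta$. If $\mu>\aleph_0$, let $E\subseteq\mu$ be a stationary set of ordinals of cofinality $\omega$, and let $\bar\zeta=\{\zeta_\nu:\nu\in E\}$ be a ladder system on $E$, that is, each $\zeta_\nu:\omega\to\nu$ is strictly increasing and cofinal in $\nu$; if $\mu=\aleph_0$, put $E=\{0\}$. Let $F$ be the free abelian group on the symbols $y_{\delta,\nu,n}$ ($\delta\in S$, $\nu\in E$, $n\in\omega$), $z_{\delta,j}$ ($\delta\in S$, $j<\mu$) and $x_\beta$ ($\beta<\lambda$), let $K$ be the subgroup of $F$ generated by the elements $$w_{\delta,\nu,n}=2y_{\delta,\nu,n+1}-y_{\delta,\nu,n}-z_{\delta,\zeta_\nu(n)}+x_{\eta_\delta(\nu+n)}\qquad(\delta\in S,\ \nu\in E,\ n\in\omega),$$ where for $\mu=\aleph_0$ the symbols $z_{\delta,j}$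 and the terms $z_{\delta,\zeta_\nu(n)}$ are omitted, and let $H$ be a group isomorphic to $F/K$ (the group built on $\bar\eta$ and $\bar\zeta$). Suppose also that, if $\mu>\aleph_0$, the diamond principle $\diamondsuit_\mu(E')$ holds for every stationary subset $E'$ of $\mu$ with $E'\subseteq E$. If $A$ is a Whitehead group (an abelian group with $\mathrm{Ext}(A,\mathbb Z)=0$) of cardinality $\lambda=\mu^+$, then $\mathrm{Ext}(H,A)\neq 0$. -/

import Mathlib

universe u

namespace WhiteheadExt

open Cardinal Set

/-- The generalized continuum hypothesis. -/
def GCH : Prop :=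
  ∀ κ : Cardinal.{u}, ℵ₀ ≤ κ → (2 : Cardinal.{u}) ^ κ = Order.succ κ

/-- `X ∩ κ` is a stationary subset of the cardinal `κ` (viewed as an initial ordinal). -/
def IsStationaryIn (κ : Cardinal.{u}) (X : Set Ordinal.{u}) : Prop :=
  IsStationary {a : Iio κ.ord | (a : Ordinal.{u}) ∈ X}

/-- The diamond principle `◇_κ(E)`. -/
def Diamond (κ : Cardinal.{u}) (E : Set Ordinal.{u}) : Prop :=
  ∃ D : Ordinal.{u} → Set Ordinal.{u}, ∀ X : Set Ordinal.{u},
    IsStationaryIn κ {α | α ∈ E ∧ X ∩ Iio α = D α}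

/-- A ladder system on `S`, with ladders indexed by the subset `I` of the ordered type `ι`:
for every `δ ∈ S` the function `η δ` is strictly increasing from `I` to `δ`, and cofinal in `δ`. -/
structure IsLadderSystem {ι : Type*} [Preorder ι] (I : Set ι) (S : Set Ordinal.{u})
    (η : Ordinal.{u} → ι → Ordinal.{u}) : Prop where
  strictMono : ∀ δ ∈ S, StrictMonoOn (η δ) I
  lt : ∀ δ ∈ S, ∀ i ∈ I, η δ i < δ
  cofinal : ∀ δ ∈ S, ∀ β < δ, ∃ i ∈ I, β ≤ η δ i

/-- The combinatorial data on the successor `λ = μ⁺` of a cardinal `μ` of cofinality `σ`: a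
stationary set `S ⊆ λ` of ordinals of cofinality `σ` with a ladder system `η` of ladders of length
`σ`; and, if `σ > ℵ₀`, a stationary set `E ⊆ σ` of ordinals of cofinality `ω` with a ladder system
`ζ` of ladders of length `ω`. If `σ = ℵ₀`, then `E = {0}` and `ζ` is irrelevant. -/
structure IsLadderPair (μ : Cardinal.{u}) (S : Set Ordinal.{u})
    (η : Ordinal.{u} → Ordinal.{u} → Ordinal.{u}) (E : Set Ordinal.{u})
    (ζ : Ordinal.{u} → ℕ → Ordinal.{u}) : Prop where
  S_subset : S ⊆ Iio (Order.succ μ).ord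
  S_cof : ∀ δ ∈ S, δ.cof = μ.ord.cof
  S_stationary : IsStationaryIn (Order.succ μ) S
  ladder_η : IsLadderSystem (Iio μ.ord.cof.ord) S η
  E_countable : μ.ord.cof = ℵ₀ → E = {0}
  E_subset : ℵ₀ < μ.ord.cof → E ⊆ Iio μ.ord.cof.ord
  E_cof : ℵ₀ < μ.ord.cof → ∀ ν ∈ E, ν.cof = ℵ₀
  E_stationary : ℵ₀ < μ.ord.cof → IsStationaryIn μ.ord.cof E
  ladder_ζ : ℵ₀ < μ.ord.cof → IsLadderSystem (univ : Set ℕ) E ζ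

/-- The symbols `y_{δ,ν,n}`, `z_{δ,j}` and `x_β`. -/
inductive Sym : Type (u + 1)
  | y (δ ν : Ordinal.{u}) (n : ℕ) : Sym
  | z (δ j : Ordinal.{u}) : Sym
  | x (β : Ordinal.{u}) : Sym

/-- The symbols that are used: `y_{δ,ν,n}` for `δ ∈ S`, `ν ∈ E`, `n ∈ ω`; `x_β` for `β < μ⁺`; and,
unless `σ = cf(μ)` is countable, `z_{δ,j}` for `δ ∈ S`, `j < σ`. -/
def symbols (μ : Cardinal.{u}) (S E : Set Ordinal.{u}) : Set Sym.{u} :=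
  {s | (∃ δ ∈ S, ∃ ν ∈ E, ∃ n : ℕ, s = Sym.y δ ν n) ∨
    (ℵ₀ < μ.ord.cof ∧ ∃ δ ∈ S, ∃ j < μ.ord.cof.ord, s = Sym.z δ j) ∨
    (∃ β < (Order.succ μ).ord, s = Sym.x β)}

/-- The free abelian group `F` on `symbols μ S E`, as the group of all finitely supported functions
with support in this set. -/
noncomputable def F (μ : Cardinal.{u}) (S E : Set Ordinal.{u}) : Submodule ℤ (Sym.{u} →₀ ℤ) :=
  Finsupp.supported ℤ ℤ (symbols μ S E)

open Classical in
/-- `w_{δ,ν,n} = 2 y_{δ,ν,n+1} - y_{δ,ν,n} - z_{δ,ζ_ν(n)} + x_{η_δ(ν+n)}`, where the term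
`z_{δ,ζ_ν(n)}` is omitted if `cf(μ)` is countable. -/
noncomputable def w (μ : Cardinal.{u}) (η : Ordinal.{u} → Ordinal.{u} → Ordinal.{u})
    (ζ : Ordinal.{u} → ℕ → Ordinal.{u}) (δ ν : Ordinal.{u}) (n : ℕ) : Sym.{u} →₀ ℤ :=
  (2 : ℤ) • Finsupp.single (Sym.y δ ν (n + 1)) 1 - Finsupp.single (Sym.y δ ν n) 1
    - (if ℵ₀ < μ.ord.cof then Finsupp.single (Sym.z δ (ζ ν n)) 1 else 0)
    + Finsupp.single (Sym.x (η δ (ν + n))) 1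

/-- The subgroup `K` generated by all `w_{δ,ν,n}` with `δ ∈ S`, `ν ∈ E`, `n ∈ ω`. -/
noncomputable def K (μ : Cardinal.{u}) (S : Set Ordinal.{u})
    (η : Ordinal.{u} → Ordinal.{u} → Ordinal.{u}) (E : Set Ordinal.{u})
    (ζ : Ordinal.{u} → ℕ → Ordinal.{u}) : Submodule ℤ (Sym.{u} →₀ ℤ) :=
  Submodule.span ℤ {v | ∃ δ ∈ S, ∃ ν ∈ E, ∃ n : ℕ, v = w μ η ζ δ ν n}

/-- `H` is (isomorphic to) the group `F / K` built on the ladder systems `η = (η_δ : δ ∈ S)` and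
`ζ = (ζ_ν : ν ∈ E)`. -/
structure IsBuiltOn (μ : Cardinal.{u}) (S : Set Ordinal.{u})
    (η : Ordinal.{u} → Ordinal.{u} → Ordinal.{u}) (E : Set Ordinal.{u})
    (ζ : Ordinal.{u} → ℕ → Ordinal.{u}) (H : Type u) [AddCommGroup H] : Prop where
  ladders : IsLadderPair μ S η E ζ
  iso : Nonempty (H ≃+ (F μ S E ⧸ (K μ S η E ζ).submoduleOf (F μ S E)))

/-- The group `Ext(H, A)` of abelian groups. -/
abbrev ExtOne (H A : Type u) [AddCommGroup H] [AddCommGroup A] : Type u :=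
  CategoryTheory.Abelian.Ext (ModuleCat.of ℤ H) (ModuleCat.of ℤ A) 1

/-- A Whitehead group: an abelian group `A` with `Ext(A, ℤ) = 0`. -/
def IsWhitehead (A : Type u) [AddCommGroup A] : Prop :=
  Subsingleton (ExtOne A (ULift.{u} ℤ))

end WhiteheadExt

-- Suppose Ext(H, A) = 0. Then the equations presenting H are solvable in A for all right-hand
-- sides. Filter A by subgroups B_δ (δ < μ⁺) of cardinality at most μ. If each B_δ had a right-hand
-- side unsolvable modulo B_δ, solve all of these at once and take δ ∈ S with x_β ∈ B_δ for all β <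
-- δ: the δ-th equations hold modulo B_δ, a contradiction. So the equations without the x-terms are
-- solvable modulo some B of cardinality at most μ, hence modulo every P ⊇ B (`exists_solvesMod`).
--
-- For such P of cardinality at most μ, the quotient A/P has a subgroup D of cardinality at most μ
-- with a character to ℚ/ℤ that does not lift to ℚ (`SolvesMod.exists_not_liftsCharacters`). If A/P
-- is 6-divisible, D can be taken countable. Otherwise fix g outside 6(A/P) and right-hand sides
-- ε_{ν,n}·g, with ε obtained from ◇ (a cardinality argument suffices for μ = ℵ₀) so that no
-- homomorphism to ℤ nonzero at g is compatible with a solution.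
--
-- These obstructions are placed along a chain of length μ⁺ in A. If all characters of A lifted, a
-- weak-diamond style coding would inject 2^(μ⁺) choices into a set of size at most 2^μ, contrary to
-- GCH (`not_liftsCharacters_of_chain`). Hence A is not a Whitehead group.

universe v

namespace WhiteheadExt

open CategoryTheory Abelian

/-! ### Vanishing of Ext as extension and lifting of homomorphisms. -/

section ExtVanishing

variable {X Y Z G : Type u} [AddCommGroup X] [AddCommGroup Y] [AddCommGroup Z] [AddCommGroup G]

theorem exists_extension_of_subsingleton_extOne {i : X →ₗ[ℤ] Y} {p : Y →ₗ[ℤ] Z}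
    (hi : Function.Injective i) (hp : Function.Surjective p) (hip : Function.Exact i p)
    (h : Subsingleton (ExtOne Z G)) (f : X →ₗ[ℤ] G) : ∃ g : Y →ₗ[ℤ] G, g ∘ₗ i = f := by
  have hS := ModuleCat.shortComplex_shortExact
    (ModuleCat.shortComplexOfCompEqZero i p hip.linearMap_comp_eq_zero) hip hi hp
  obtain ⟨g, hg⟩ := Ext.contravariant_sequence_exact₁ hS (ModuleCat.of ℤ G)
    (Ext.mk₀ (ModuleCat.ofHom f)) (n₁ := 1) rfl (@Subsingleton.elim _ h _ _)
  obtain ⟨g, rfl⟩ := (Ext.mk₀_bijective _ _).2 g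
  rw [Ext.mk₀_comp_mk₀] at hg
  have := (Ext.mk₀_bijective _ _).1 hg
  exact ⟨g.hom, congrArg ModuleCat.Hom.hom this⟩

theorem exists_lift_of_subsingleton_extOne {i : X →ₗ[ℤ] Y} {p : Y →ₗ[ℤ] Z}
    (hi : Function.Injective i) (hp : Function.Surjective p) (hip : Function.Exact i p)
    (h : Subsingleton (ExtOne G X)) (f : G →ₗ[ℤ] Z) : ∃ g : G →ₗ[ℤ] Y, p ∘ₗ g = f := by
  have hS := ModuleCat.shortComplex_shortExact
    (ModuleCat.shortComplexOfCompEqZero i p hip.linearMap_comp_eq_zero) hip hi hp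
  obtain ⟨g, hg⟩ := Ext.covariant_sequence_exact₃ (ModuleCat.of ℤ G) hS
    (Ext.mk₀ (ModuleCat.ofHom f)) (n₁ := 1) rfl (@Subsingleton.elim _ h _ _)
  obtain ⟨g, rfl⟩ := (Ext.mk₀_bijective _ _).2 g
  rw [Ext.mk₀_comp_mk₀] at hg
  have := (Ext.mk₀_bijective _ _).1 hg
  exact ⟨g.hom, congrArg ModuleCat.Hom.hom this⟩

end ExtVanishing

/-- If `Ext(H, A) = 0` and `H ≅ F / K`, then homomorphisms `K → A` extend to `F`, where `F` may
live in a larger universe. -/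
theorem exists_extension_of_subsingleton_extOne_of_small {M : Type v} [AddCommGroup M]
    (N : Submodule ℤ M) [Small.{u} M] {H A : Type u} [AddCommGroup H] [AddCommGroup A]
    (e : H ≃+ (M ⧸ N)) (h : Subsingleton (ExtOne H A)) (f : N →ₗ[ℤ] A) :
    ∃ g : M →ₗ[ℤ] A, ∀ x : N, g x = f x := by
  let eM := Shrink.linearEquiv.{u} ℤ M
  let eN := Shrink.linearEquiv.{u} ℤ N
  let i : Shrink.{u} N →ₗ[ℤ] Shrink.{u} M := eM.symm.toLinearMap ∘ₗ N.subtype ∘ₗ eN.toLinearMap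
  let p : Shrink.{u} M →ₗ[ℤ] H :=
    e.symm.toIntLinearEquiv.toLinearMap ∘ₗ N.mkQ ∘ₗ eM.toLinearMap
  have hi : Function.Injective i :=
    eM.symm.injective.comp (N.injective_subtype.comp eN.injective)
  have hp : Function.Surjective p :=
    e.symm.surjective.comp (N.mkQ_surjective.comp eM.surjective)
  have hip : Function.Exact i p := by
    intro y
    constructor
    · intro hy
      have hy : e.symm (N.mkQ (eM y)) = 0 := hy
      rw [map_eq_zero_iff _ e.symm.injective, Submodule.mkQ_apply,
        Submodule.Quotient.mk_eq_zero] at hy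
      exact ⟨eN.symm ⟨eM y, hy⟩, by simp [i]⟩
    · rintro ⟨x, rfl⟩
      simp [i, p]
  obtain ⟨g, hg⟩ := exists_extension_of_subsingleton_extOne hi hp hip h (f ∘ₗ eN.toLinearMap)
  refine ⟨g ∘ₗ eM.symm.toLinearMap, fun x => ?_⟩
  have := LinearMap.congr_fun hg (eN.symm x)
  simpa [i] using this

/-- Every homomorphism to `ℚ / ℤ` lifts to `ℚ`. -/
def LiftsCharacters (D : Type*) [AddCommGroup D] : Prop :=
  ∀ χ : D →+ AddCircle (1 : ℚ), ∃ ψ : D →+ ℚ, ∀ d, (ψ d : AddCircle (1 : ℚ)) = χ d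

/-- Apply the lifting property to 0 → ℤ → ℚ → ℚ/ℤ → 0. This is the only consequence of Ext(A, ℤ) = 0
that the later arguments need. -/
theorem IsWhitehead.liftsCharacters {A : Type u} [AddCommGroup A] (hA : IsWhitehead A) :
    LiftsCharacters A := by
  intro χ
  let i : ULift.{u} ℤ →ₗ[ℤ] ULift.{u} ℚ :=
    (AddEquiv.ulift.symm.toAddMonoidHom.comp
      ((Int.castAddHom ℚ).comp AddEquiv.ulift.toAddMonoidHom)).toIntLinearMap
  let p : ULift.{u} ℚ →ₗ[ℤ] ULift.{u} (AddCircle (1 : ℚ)) :=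
    (AddEquiv.ulift.symm.toAddMonoidHom.comp
      ((QuotientAddGroup.mk' _).comp AddEquiv.ulift.toAddMonoidHom)).toIntLinearMap
  have hi : Function.Injective i := by
    rintro ⟨x⟩ ⟨y⟩ hxy
    have : (x : ℚ) = y := congrArg ULift.down hxy
    exact congrArg ULift.up (by exact_mod_cast this)
  have hp : Function.Surjective p := by
    rintro ⟨x⟩
    obtain ⟨x, rfl⟩ := QuotientAddGroup.mk_surjective x
    exact ⟨⟨x⟩, rfl⟩
  have hip : Function.Exact i p := by
    rintro ⟨y⟩
    constructor
    · intro hy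
      have hy : (y : AddCircle (1 : ℚ)) = 0 := congrArg ULift.down hy
      obtain ⟨n, hn⟩ := (AddCircle.coe_eq_zero_iff _).1 hy
      exact ⟨⟨n⟩, congrArg ULift.up ((zsmul_one n).symm.trans hn)⟩
    · rintro ⟨⟨n⟩, hn⟩
      have hn : (n : ℚ) = y := congrArg ULift.down hn
      exact congrArg ULift.up ((AddCircle.coe_eq_zero_iff _).2 ⟨n, (zsmul_one n).trans hn⟩)
  obtain ⟨g, hg⟩ := exists_lift_of_subsingleton_extOne hi hp hip hA
    (AddEquiv.ulift.symm.toAddMonoidHom.comp χ).toIntLinearMap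
  refine ⟨AddEquiv.ulift.toAddMonoidHom.comp g.toAddMonoidHom, fun d => ?_⟩
  exact congrArg ULift.down (LinearMap.congr_fun hg d)

end WhiteheadExt

/-! ### Groups with characters that do not lift to ℚ. -/

namespace WhiteheadExt

section LiftsCharacters

variable {C D : Type*} [AddCommGroup C] [AddCommGroup D]

theorem exists_addMonoidHom_extension {f : C →+ D} (hf : Function.Injective f)
    (χ : C →+ AddCircle (1 : ℚ)) : ∃ χ' : D →+ AddCircle (1 : ℚ), ∀ c, χ' (f c) = χ c := by
  obtain ⟨χ', h⟩ := CharacterModule.dual_surjective_of_injective (R := ℤ) f.toIntLinearMap hf χ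
  exact ⟨χ', fun c => DFunLike.congr_fun h c⟩

theorem exists_character_of_notMem (N : AddSubgroup D) {g : D} (hg : g ∉ N) :
    ∃ χ : D →+ AddCircle (1 : ℚ), (∀ d ∈ N, χ d = 0) ∧ χ g ≠ 0 := by
  obtain ⟨χ, hχ⟩ := CharacterModule.exists_character_apply_ne_zero_of_ne_zero
    (a := (g : D ⧸ N)) (by rwa [Ne, QuotientAddGroup.eq_zero_iff])
  refine ⟨AddMonoidHom.comp χ (QuotientAddGroup.mk' N), fun d hd => ?_, hχ⟩
  have : (d : D ⧸ N) = 0 := (QuotientAddGroup.eq_zero_iff d).2 hd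
  change χ (d : D ⧸ N) = 0
  rw [this, map_zero]

theorem exists_int_eq_of_addCircle_coe_eq_zero {q : ℚ} (h : (q : AddCircle (1 : ℚ)) = 0) :
    ∃ k : ℤ, (k : ℚ) = q := by
  obtain ⟨k, hk⟩ := (AddCircle.coe_eq_zero_iff _).1 h
  exact ⟨k, (zsmul_one k).symm.trans hk⟩

/-- Lift a character that kills nD but not g. The lift ψ takes values in (1/n)ℤ, so nψ is integer
valued, and ψ(g) ≠ 0. -/
theorem LiftsCharacters.exists_hom_int (hD : LiftsCharacters D) {n : ℕ} (hn : n ≠ 0) {g : D}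
    (hg : ∀ d : D, n • d ≠ g) : ∃ φ : D →+ ℤ, φ g ≠ 0 := by
  obtain ⟨χ, hχ, hχg⟩ := exists_character_of_notMem (nsmulAddMonoidHom n : D →+ D).range
    (g := g) (by rintro ⟨d, hd⟩; exact hg d hd)
  obtain ⟨ψ, hψ⟩ := hD χ
  have hint : ∀ d, ∃ k : ℤ, (k : ℚ) = n • ψ d := fun d => by
    rw [← map_nsmul]
    exact exists_int_eq_of_addCircle_coe_eq_zero ((hψ _).trans (hχ _ ⟨d, rfl⟩))
  choose k hk using hint
  refine ⟨⟨⟨k, ?_⟩, ?_⟩, ?_⟩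
  · have := hk 0
    rw [map_zero, smul_zero] at this
    exact_mod_cast this
  · intro x y
    have : (k (x + y) : ℚ) = k x + k y := by simp [hk]
    exact_mod_cast this
  · intro h0
    have h0 : k g = 0 := h0
    have := hk g
    rw [h0, Int.cast_zero, eq_comm, smul_eq_zero] at this
    exact hχg (by rw [← hψ, this.resolve_left hn, AddCircle.coe_zero])

theorem not_liftsCharacters_of_nsmul_eq_zero {t : D} (ht : t ≠ 0) {n : ℕ} (hn : n ≠ 0)
    (hnt : n • t = 0) : ¬ LiftsCharacters D := by
  intro hD
  obtain ⟨χ, -, hχ⟩ := exists_character_of_notMem (⊥ : AddSubgroup D) (g := t) (by simpa using ht)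
  obtain ⟨ψ, hψ⟩ := hD χ
  have : n • ψ t = 0 := by rw [← map_nsmul, hnt, map_zero]
  exact hχ (by rw [← hψ, (smul_eq_zero.1 this).resolve_left hn, AddCircle.coe_zero])

/-- The elements `h n` behave like 6⁻ⁿ, and `g n` below like 2⁻ⁿ. Take a character killing every `g
n` but not `2 • h 1`, which behaves like 1/3. A lift would be integral on all 2⁻ⁿ, hence zero at `h
0` and at `2 • h 1`. -/
theorem not_liftsCharacters_of_six_divisible_seq (h : ℕ → D) (h0 : h 0 ≠ 0)
    (hh : ∀ n, 6 • h (n + 1) = h n) : ¬ LiftsCharacters D := by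
  intro hD
  have htf : ∀ n : ℕ, n ≠ 0 → n • h 0 ≠ 0 := fun n hn hn0 =>
    not_liftsCharacters_of_nsmul_eq_zero h0 hn hn0 hD
  set g : ℕ → D := fun n => 3 ^ n • h n with hg
  have hgs : ∀ n, 2 • g (n + 1) = g n := fun n => by
    simp only [hg, ← hh n, smul_smul]
    congr 1
    ring
  have hgp : ∀ n, 2 ^ n • g n = h 0 := by
    intro n
    induction n with
    | zero => simp [hg]
    | succ n ih => rw [pow_succ, mul_smul, hgs, ih]
  obtain ⟨χ, hχ, hχ1⟩ := exists_character_of_notMem (AddSubgroup.closure (Set.range g))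
    (g := 2 • h 1) (by
      intro hmem
      have : ∃ n : ℕ, ∃ k : ℤ, 2 • h 1 = k • g n := by
        have key : ∀ x ∈ AddSubgroup.closure (Set.range g), ∃ n : ℕ, ∃ k : ℤ, x = k • g n := by
          intro x hx
          have hle : ∀ n m, ∃ k : ℤ, g n = k • g (n + m) := by
            intro n m
            induction m with
            | zero => exact ⟨1, by simp⟩
            | succ m ih =>
              obtain ⟨k, hk⟩ := ih
              refine ⟨k * 2, ?_⟩
              rw [hk, mul_smul, ← hgs (n + m)]
              norm_cast
          induction hx using AddSubgroup.closure_induction with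
          | mem x hx => obtain ⟨n, rfl⟩ := hx; exact ⟨n, 1, by simp⟩
          | zero => exact ⟨0, 0, by simp⟩
          | add x y _ _ hx hy =>
            obtain ⟨n, k, rfl⟩ := hx
            obtain ⟨m, l, rfl⟩ := hy
            obtain ⟨k', hk'⟩ := hle n m
            obtain ⟨l', hl'⟩ := hle m n
            refine ⟨n + m, k * k' + l * l', ?_⟩
            rw [hk', hl', add_comm m n, smul_smul, smul_smul, add_smul]
          | neg x _ hx =>
            obtain ⟨n, k, rfl⟩ := hx
            exact ⟨n, -k, by simp⟩
        exact key _ hmem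
      obtain ⟨n, k, hk⟩ := this
      -- Multiplying by 3·2ⁿ turns membership into a relation on `h 0`, and torsion-freeness then
      -- gives 3 ∣ 2ⁿ.
      have h1 : (2 : ℤ) ^ n • h 0 = (3 * k) • h 0 := by
        have e1 : (3 : ℤ) • (2 • h 1) = h 0 := by
          rw [← hh 0, zero_add]
          rw [← natCast_zsmul, ← natCast_zsmul, smul_smul]
          norm_num
        calc (2 : ℤ) ^ n • h 0 = (2 : ℤ) ^ n • ((3 : ℤ) • (2 • h 1)) := by rw [e1]
          _ = (3 * k) • ((2 : ℤ) ^ n • g n) := by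
            rw [hk, smul_smul, smul_smul, smul_smul]; congr 1; ring
          _ = (3 * k) • h 0 := by
            congr 1
            rw [← hgp n, ← natCast_zsmul]; simp
      rw [← sub_eq_zero, ← sub_smul] at h1
      have hz : (2 : ℤ) ^ n - 3 * k = 0 := by
        by_contra hne
        refine htf (Int.natAbs (2 ^ n - 3 * k)) (by simpa using hne) ?_
        rw [← natCast_zsmul]
        rcases Int.natAbs_eq ((2 : ℤ) ^ n - 3 * k) with h | h
        · rw [← h, h1]
        · rw [eq_neg_iff_add_eq_zero, add_comm, ← eq_neg_iff_add_eq_zero] at h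
          rw [h, neg_smul, h1, neg_zero]
      have h3 : (3 : ℤ) ∣ 2 ^ n := ⟨k, by linarith⟩
      have := Int.prime_three.dvd_of_dvd_pow h3
      norm_num at this)
  obtain ⟨ψ, hψ⟩ := hD χ
  have hint : ∀ n, ∃ k : ℤ, (k : ℚ) = ψ (g n) := fun n =>
    exists_int_eq_of_addCircle_coe_eq_zero
      ((hψ _).trans (hχ _ (AddSubgroup.subset_closure ⟨n, rfl⟩)))
  choose k hk using hint
  have hk0 : ∀ n, (2 : ℤ) ^ n * k n = k 0 := fun n => by
    have : ((2 : ℤ) ^ n * k n : ℚ) = k 0 := by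
      have := congrArg ψ (hgp n)
      rw [map_nsmul, ← hk, nsmul_eq_mul] at this
      have h00 : h 0 = g 0 := by simp [hg]
      rw [h00, ← hk] at this
      exact_mod_cast this
    exact_mod_cast this
  have hk00 : k 0 = 0 := by
    by_contra hne
    have hd : (2 : ℤ) ^ (k 0).natAbs ∣ k 0 := ⟨_, (hk0 _).symm⟩
    have := Nat.le_of_dvd (Int.natAbs_pos.2 hne) (by simpa [Int.natAbs_pow] using Int.natAbs_dvd_natAbs.2 hd)
    exact absurd this (not_le.2 Nat.lt_two_pow_self)
  have hψ0 : ψ (h 0) = 0 := by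
    have h00 : h 0 = g 0 := by simp [hg]
    rw [h00, ← hk, hk00, Int.cast_zero]
  rw [← hh 0, map_nsmul, zero_add, smul_eq_zero] at hψ0
  refine hχ1 ?_
  rw [← hψ, map_nsmul, hψ0.resolve_left (by norm_num), smul_zero, AddCircle.coe_zero]

theorem mk_addSubgroup_closure_le (s : Set C) :
    Cardinal.mk (AddSubgroup.closure s) ≤ max (Cardinal.mk s) Cardinal.aleph0 := by
  let f : List (s ⊕ s) → C := fun l => (l.map (Sum.elim (fun x : s => (x : C)) fun x : s => -(x : C))).sum
  have hf : (AddSubgroup.closure s : Set C) ⊆ Set.range f := by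
    intro x hx
    induction hx using AddSubgroup.closure_induction'' with
    | mem x hx => exact ⟨[Sum.inl ⟨x, hx⟩], by simp [f]⟩
    | neg_mem x hx => exact ⟨[Sum.inr ⟨x, hx⟩], by simp [f]⟩
    | zero => exact ⟨[], by simp [f]⟩
    | add x y _ _ hx hy =>
      obtain ⟨l, rfl⟩ := hx
      obtain ⟨l', rfl⟩ := hy
      exact ⟨l ++ l', by simp [f]⟩
  refine (Cardinal.mk_le_mk_of_subset hf).trans (Cardinal.mk_range_le.trans ?_)
  refine (Cardinal.mk_list_le_max _).trans ?_
  rw [Cardinal.mk_sum, Cardinal.lift_id]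
  exact max_le (le_max_right _ _) ((Cardinal.add_le_max _ _).trans (by simp))

theorem exists_countable_not_liftsCharacters_of_divisible [Nontrivial C]
    (hC : ∀ c : C, ∃ d, 6 • d = c) :
    ∃ D : AddSubgroup C, Countable D ∧ ¬ LiftsCharacters D := by
  obtain ⟨c, hc⟩ := exists_ne (0 : C)
  choose s hs using hC
  let h : ℕ → C := fun n => s^[n] c
  have hh : ∀ n, 6 • h (n + 1) = h n := fun n => by
    simp only [h, Function.iterate_succ_apply', hs]
  let D := AddSubgroup.closure (Set.range h)
  refine ⟨D, ?_, not_liftsCharacters_of_six_divisible_seq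
    (fun n => ⟨h n, AddSubgroup.subset_closure ⟨n, rfl⟩⟩) ?_ ?_⟩
  · rw [← Cardinal.mk_le_aleph0_iff]
    exact (mk_addSubgroup_closure_le _).trans (max_le (Set.countable_range h).le_aleph0 le_rfl)
  · intro h0
    exact hc (congrArg Subtype.val h0)
  · intro n
    exact Subtype.ext (hh n)

end LiftsCharacters

end WhiteheadExt

/-! ### Unsolvable integer recursions, clubs of closure points, and guessing by diamond. -/

namespace WhiteheadExt

open Cardinal Set

/-- If every 0-1 sequence ε admitted a solution, two different ones would share m and y 0, since
there are only countably many such pairs. The difference d of the solutions vanishes up to the first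
disagreement k, and afterwards 2^(N+1)·d(k+N+1) is m times an odd number. So every power of 2
divides m ≠ 0, which is absurd. -/
theorem exists_unsolvable (z : ℕ → ℤ) : ∃ ε : ℕ → ℤ, ∀ m : ℤ, m ≠ 0 → ∀ y : ℕ → ℤ,
    ¬ ∀ n, 2 * y (n + 1) - y n = z n + ε n * m := by
  by_contra! hcon
  let e : (ℕ → Bool) → ℕ → ℤ := fun b n => if b n then 1 else 0
  choose m hm y hy using fun b : ℕ → Bool => hcon (e b)
  have hinj : Function.Injective fun b => (m b, y b 0) := by
    intro b b' hbb'
    obtain ⟨hmm, hy0⟩ := Prod.mk.inj hbb'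
    by_contra hne
    have hex : ∃ n, b n ≠ b' n := by
      by_contra! h
      exact hne (funext h)
    classical
    let k := Nat.find hex
    have hlt : ∀ n < k, b n = b' n := fun n hn => not_not.1 (Nat.find_min hex hn)
    let d : ℕ → ℤ := fun n => y b n - y b' n
    have hd : ∀ n, 2 * d (n + 1) = d n + (e b n - e b' n) * m b := fun n => by
      have h1 := hy b n
      have h2 := hy b' n
      rw [← hmm] at h2
      simp only [d]
      linear_combination h1 - h2
    have hd0 : ∀ n ≤ k, d n = 0 := by
      intro n
      induction n with
      | zero => intro _; exact sub_eq_zero.2 hy0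
      | succ n ih =>
        intro hn
        have := hd n
        simp only [e] at this
        rw [ih (by omega), hlt n (by omega)] at this
        simpa using this
    have hodd : Odd (e b k - e b' k) := by
      have := Nat.find_spec hex
      change b k ≠ b' k at this
      cases h : b k <;> cases h' : b' k <;> simp_all [e]
    have key : ∀ N : ℕ, ∃ o : ℤ, Odd o ∧ 2 ^ (N + 1) * d (k + (N + 1)) = m b * o := by
      intro N
      induction N with
      | zero => exact ⟨_, hodd, by have := hd k; rw [hd0 k le_rfl] at this; linear_combination this⟩
      | succ N ih =>
        obtain ⟨o, ho, h⟩ := ih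
        refine ⟨o + 2 ^ (N + 1) * (e b (k + (N + 1)) - e b' (k + (N + 1))),
          ho.add_even ((even_two.pow_of_ne_zero (by omega)).mul_right _), ?_⟩
        have := hd (k + (N + 1))
        rw [← add_assoc k (N + 1) 1]
        linear_combination 2 ^ (N + 1) * this + h
    have hdvd : ∀ N : ℕ, (2 : ℤ) ^ (N + 1) ∣ m b := fun N => by
      obtain ⟨o, ho, h⟩ := key N
      exact IsCoprime.dvd_of_dvd_mul_right (Int.isCoprime_two_left.2 ho).pow_left ⟨_, h.symm⟩
    have := Nat.le_of_dvd (Int.natAbs_pos.2 (hm b))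
      (by simpa [Int.natAbs_pow] using Int.natAbs_dvd_natAbs.2 (hdvd (m b).natAbs))
    exact absurd this (not_le.2 ((Nat.lt_succ_self _).trans Nat.lt_two_pow_self))
  have : Countable (ℕ → Bool) := hinj.countable
  have := Cardinal.mk_le_aleph0_iff.2 this
  rw [← Cardinal.power_def, Cardinal.mk_bool, Cardinal.mk_nat, Cardinal.two_power_aleph0] at this
  exact Cardinal.aleph0_lt_continuum.not_ge this

theorem isClub_closed_under {κ : Cardinal.{u}} (hκ : κ.IsRegular) (hκ' : ℵ₀ < κ)
    (f : Ordinal.{u} → Ordinal.{u}) (hf : ∀ β < κ.ord, f β < κ.ord) :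
    IsClub {a : Iio κ.ord | ∀ β < (a : Ordinal), f β < a} := by
  constructor
  · intro s hs hs0 _ a ha β hβ
    have : ∃ b ∈ s, β < (b : Ordinal) := by
      by_contra! h
      have hβκ : β < κ.ord := hβ.trans a.2
      exact absurd (ha.2 (show (⟨β, hβκ⟩ : Iio κ.ord) ∈ upperBounds s from fun b hb => h b hb))
        (not_le.2 hβ)
    obtain ⟨b, hb, hβb⟩ := this
    exact (hs hb β hβb).trans_le (ha.1 hb)
  · intro a
    -- Here `g a` bounds `f` on all of `Iio a`, so the supremum of the iterates of `g` is closed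
    -- under `f`.
    let g : Ordinal.{u} → Ordinal.{u} := fun a => max a (⨆ β : Iio a, f β + 1)
    have hg : ∀ a < κ.ord, g a < κ.ord := fun a ha => by
      refine max_lt ha (Ordinal.lift_iSup_add_one_lt_of_lt_cof ?_ fun β => hf _ (β.2.trans ha))
      rw [Cardinal.mk_Iio_ordinal, ← Ordinal.lift_cof, hκ.cof_ord, Cardinal.lift_lift,
        Cardinal.lift_lt]
      exact Cardinal.lt_ord.1 ha
    refine ⟨⟨Ordinal.nfp g a, Cardinal.nfp_lt_ord_of_isRegular hκ hκ'.ne' hg a.2⟩, ?_,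
      Ordinal.le_nfp g a⟩
    intro β hβ
    obtain ⟨n, hn⟩ := Ordinal.lt_nfp_iff.1 hβ
    refine lt_of_lt_of_le ?_ (Ordinal.iterate_le_nfp g a (n + 1))
    rw [Function.iterate_succ_apply']
    refine lt_of_lt_of_le ?_ (le_max_right _ _)
    exact (Order.lt_add_one_iff.2 le_rfl).trans_le
      (Ordinal.le_iSup (fun β : Iio (g^[n] a) => f β + 1) ⟨β, hn⟩)

theorem IsStationaryIn.exists_closed_under {κ : Cardinal.{u}} {X : Set Ordinal.{u}}
    (hX : IsStationaryIn κ X) (hκ : κ.IsRegular) (hκ' : ℵ₀ < κ)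
    (f : Ordinal.{u} → Ordinal.{u}) (hf : ∀ β < κ.ord, f β < κ.ord) :
    ∃ a ∈ X, a < κ.ord ∧ ∀ β < a, f β < a := by
  obtain ⟨a, ha, ha'⟩ := hX (isClub_closed_under hκ hκ' f hf)
  exact ⟨a, ha, a.2, ha'⟩

/-- The diamond principle, for guessing integer valued functions. -/
theorem Diamond.exists_guess {κ : Cardinal.{u}} {E : Set Ordinal.{u}} (h : Diamond κ E)
    (hκ : κ.IsRegular) (hκ' : ℵ₀ < κ) :
    ∃ G : Ordinal.{u} → Ordinal.{u} → ℤ, ∀ z : Ordinal.{u} → ℤ, ∃ ν ∈ E,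
      ∀ j < ν, G ν j = z j := by
  obtain ⟨D, hD⟩ := h
  classical
  -- An integer-valued function is coded by its graph, the pair (j, i) becoming the ordinal ω·j +
  -- code(i).
  let c : Ordinal.{u} → ℤ → Ordinal.{u} := fun j i => Ordinal.omega0 * j + (Encodable.encode i : ℕ)
  have hc : ∀ {j j' i i'}, c j i = c j' i' → j = j' ∧ i = i' := by
    intro j j' i i' hij
    have h0 : (Ordinal.omega0 : Ordinal.{u}) ≠ 0 := Ordinal.omega0_ne_zero
    have h1 := congrArg (· / Ordinal.omega0) hij
    have h2 := congrArg (· % Ordinal.omega0) hij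
    simp only [c, Ordinal.mul_add_div _ h0, Ordinal.mul_add_mod_self,
      Ordinal.div_eq_zero_of_lt (Ordinal.natCast_lt_omega0 _),
      Ordinal.mod_eq_of_lt (Ordinal.natCast_lt_omega0 _), add_zero, Nat.cast_inj] at h1 h2
    exact ⟨h1, Encodable.encode_injective h2⟩
  refine ⟨fun ν j => if h : ∃ i, c j i ∈ D ν then h.choose else 0, fun z => ?_⟩
  -- Closure under j ↦ ω·j + ω keeps the codes of all values at j < ν below ν, where the guess is
  -- correct.
  obtain ⟨ν, ⟨hνE, hν⟩, hνκ, hcl⟩ := (hD {α | ∃ j, α = c j (z j)}).exists_closed_under hκ hκ'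
    (fun j => Ordinal.omega0 * j + Ordinal.omega0) (by
      intro β hβ
      rw [Cardinal.lt_ord] at hβ ⊢
      rw [Ordinal.card_add, Ordinal.card_mul, Ordinal.card_omega0]
      exact Cardinal.add_lt_of_lt hκ.aleph0_le (Cardinal.mul_lt_of_lt hκ.aleph0_le hκ' hβ) hκ')
  refine ⟨ν, hνE, fun j hj => ?_⟩
  have hmem : ∀ i, c j i ∈ D ν ↔ i = z j := by
    intro i
    rw [← hν]
    constructor
    · rintro ⟨⟨j', hj'⟩, -⟩
      obtain ⟨rfl, h⟩ := hc hj'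
      exact h
    · rintro rfl
      refine ⟨⟨j, rfl⟩, lt_of_le_of_lt ?_ (hcl j hj)⟩
      exact add_le_add_right (Ordinal.natCast_lt_omega0 _).le _
  have hex : ∃ i, c j i ∈ D ν := ⟨z j, (hmem _).2 rfl⟩
  simp only [dif_pos hex]
  exact (hmem _).1 hex.choose_spec

end WhiteheadExt

/-! ### Chains of subgroups with obstructions, and the counting argument. -/

namespace WhiteheadExt

open Cardinal Set

section Chain

variable {A : Type u} [AddCommGroup A] {L : Type u} [LinearOrder L]

/-- The compatible homomorphisms have a common extension to the union of their domains, and ℚ/ℤ is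
injective. -/
theorem exists_glue {I : Set L} {N : L → AddSubgroup A} (hN : Monotone N)
    (F : L → A →+ AddCircle (1 : ℚ))
    (hF : ∀ γ ∈ I, ∀ β < γ, ∀ x ∈ N β, F γ x = F β x) :
    ∃ φ : A →+ AddCircle (1 : ℚ), ∀ β ∈ I, ∀ x ∈ N β, φ x = F β x := by
  let p : L → A →ₗ.[ℤ] AddCircle (1 : ℚ) := fun β =>
    (F β).toIntLinearMap.toPMap (AddSubgroup.toIntSubmodule (N β))
  have hp : ∀ γ ∈ I, ∀ β ≤ γ, p β ≤ p γ := by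
    intro γ hγ β hβ
    refine ⟨fun x hx => hN hβ hx, fun x y hxy => ?_⟩
    change F β x = F γ y
    rw [← hxy]
    rcases hβ.eq_or_lt with rfl | hlt
    · rfl
    · exact (hF γ hγ β hlt x x.2).symm
  have hdir : DirectedOn (· ≤ ·) (p '' I) := by
    rintro _ ⟨β, hβ, rfl⟩ _ ⟨γ, hγ, rfl⟩
    rcases le_total β γ with h | h
    · exact ⟨p γ, ⟨γ, hγ, rfl⟩, hp γ hγ β h, le_rfl⟩
    · exact ⟨p β, ⟨β, hβ, rfl⟩, le_rfl, hp β hβ γ h⟩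
  let q := LinearPMap.sSup (p '' I) hdir
  obtain ⟨φ, hφ⟩ := exists_addMonoidHom_extension (f := q.domain.subtype.toAddMonoidHom)
    q.domain.injective_subtype q.toFun.toAddMonoidHom
  refine ⟨φ, fun β hβ x hx => ?_⟩
  have hmem : p β ∈ p '' I := ⟨β, hβ, rfl⟩
  have h1 := LinearPMap.sSup_apply hdir hmem ⟨x, hx⟩
  exact (hφ ⟨x, (LinearPMap.le_sSup hdir hmem).1 hx⟩).trans h1

variable [WellFoundedLT L] (N : L → AddSubgroup A) (χ : L → A →+ AddCircle (1 : ℚ))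

open Classical in
/-- A homomorphism which extends a given family of homomorphisms on the subgroups below `α`. -/
noncomputable def glueBelow (α : L) (F : ∀ β, β < α → A →+ AddCircle (1 : ℚ)) :
    A →+ AddCircle (1 : ℚ) :=
  if h : ∃ φ : A →+ AddCircle (1 : ℚ), ∀ β, ∀ hβ : β < α, ∀ x ∈ N β, φ x = F β hβ x
    then h.choose else 0

/-- The homomorphism on stage `α` which is obtained from the choices `η`. -/
noncomputable def stageHom (η : L → Bool) : L → A →+ AddCircle (1 : ℚ) :=
  wellFounded_lt.fix fun α F => glueBelow N α F + if η α then χ α else 0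

theorem stageHom_eq (η : L → Bool) (α : L) : stageHom N χ η α =
    glueBelow N α (fun β _ => stageHom N χ η β) + if η α then χ α else 0 :=
  wellFounded_lt.fix_eq _ _

theorem stageHom_congr {η η' : L → Bool} {α : L} (h : ∀ β < α, η β = η' β) :
    ∀ β < α, stageHom N χ η β = stageHom N χ η' β := by
  intro β
  induction β using WellFoundedLT.induction with
  | ind β ih =>
    intro hβ
    rw [stageHom_eq, stageHom_eq, h β hβ]
    congr 2
    funext γ hγ
    exact ih γ hγ (hγ.trans hβ)

variable {N χ}

/-- Adding `χ γ` does not disturb earlier stages, where it vanishes. Coherence below γ makes gluing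
possible, so the default 0 in `glueBelow` is never used. -/
theorem stageHom_coherent (hN : Monotone N) (hχ : ∀ γ, ∀ β < γ, ∀ x ∈ N β, χ γ x = 0)
    (η : L → Bool) (γ : L) :
    ∀ β < γ, ∀ x ∈ N β, stageHom N χ η γ x = stageHom N χ η β x := by
  induction γ using WellFoundedLT.induction with
  | ind γ ih =>
    intro β hβ x hx
    have hex : ∃ φ : A →+ AddCircle (1 : ℚ), ∀ β, ∀ _ : β < γ, ∀ x ∈ N β,
        φ x = stageHom N χ η β x := exists_glue (I := Iio γ) hN (stageHom N χ η) ih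
    rw [stageHom_eq, glueBelow, dif_pos hex, AddMonoidHom.add_apply, hex.choose_spec β hβ x hx]
    split_ifs
    · rw [hχ γ β hβ x hx, add_zero]
    · rw [AddMonoidHom.zero_apply, add_zero]

/-- If the steps of a chain `N` of subgroups of `A` carry obstructions `χ` to lifting homomorphisms,
then a choice `η` of obstructions can be read off from liftings. -/
theorem LiftsCharacters.exists_determined (hA : LiftsCharacters A) {P : L → AddSubgroup A}
    (hPN : ∀ α, P α ≤ N α) (hNP : ∀ γ, ∀ β < γ, N β ≤ P γ)
    (hχ : ∀ α, ∀ x ∈ P α, χ α x = 0)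
    (hobs : ∀ α, ∀ ψ : A →+ ℚ, (∀ x ∈ P α, ψ x = 0) →
      ¬ ∀ x ∈ N α, (ψ x : AddCircle (1 : ℚ)) = χ α x) :
    ∃ g : (L → Bool) → A →+ ℚ, ∀ η η' α, (∀ β < α, η β = η' β) →
      (∀ x ∈ P α, g η x = g η' x) → η α = η' α := by
  have hN : Monotone N := fun β γ h => by
    rcases h.eq_or_lt with rfl | h
    · exact le_rfl
    · exact (hNP γ β h).trans (hPN γ)
  have hlift : ∀ η, ∃ g : A →+ ℚ, ∀ α, ∀ x ∈ N α,
      (g x : AddCircle (1 : ℚ)) = stageHom N χ η α x := by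
    intro η
    obtain ⟨φ, hφ⟩ := exists_glue (I := univ) hN (stageHom N χ η) fun γ _ =>
      stageHom_coherent hN (fun γ β h x hx => hχ γ x (hNP γ β h hx)) η γ
    obtain ⟨g, hg⟩ := hA φ
    exact ⟨g, fun α x hx => (hg x).trans (hφ α (mem_univ α) x hx)⟩
  choose g hg using hlift
  have key : ∀ η η' α, (∀ β < α, η β = η' β) → (∀ x ∈ P α, g η x = g η' x) →
      η α = true → η' α = false → False := by
    intro η η' α hη hP h1 h2
    -- The difference of the two lifts vanishes on `P α` and would lift `χ α` on `N α`.
    refine hobs α (g η - g η') (fun x hx => by simp [hP x hx]) fun x hx => ?_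
    have e := stageHom_congr N χ hη
    have e' : glueBelow N α (fun β _ => stageHom N χ η β) =
        glueBelow N α (fun β _ => stageHom N χ η' β) := by
      congr 1
      funext β hβ
      exact e β hβ
    rw [AddMonoidHom.sub_apply, AddCircle.coe_sub, hg η α x hx, hg η' α x hx, stageHom_eq,
      stageHom_eq N χ η', e', h1, h2]
    simp
  refine ⟨g, fun η η' α hη hP => ?_⟩
  cases h1 : η α <;> cases h2 : η' α
  · rfl
  · exact (key η' η α (fun β h => (hη β h).symm) (fun x hx => (hP x hx).symm) h2 h1).elim
  · exact (key η η' α hη hP h1 h2).elim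
  · rfl

end Chain

theorem mk_fun_rat_le {X : Type u} {μ : Cardinal.{u}} (hμ : ℵ₀ ≤ μ) (hX : #X ≤ μ) :
    #(X → ℚ) ≤ 2 ^ μ := by
  rw [mk_arrow, Cardinal.mkRat, lift_aleph0, Cardinal.lift_uzero]
  calc ℵ₀ ^ #X ≤ ℵ₀ ^ μ := power_le_power_left aleph0_ne_zero hX
    _ = 2 ^ μ := power_eq_two_power hμ (ofNat_le_aleph0 (n := 2)) hμ

/-- A group containing a chain of length `μ⁺` of subgroups of cardinality `μ`, each step of which
obstructs lifting, has a homomorphism to `ℚ / ℤ` which does not lift to `ℚ`. -/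
theorem not_liftsCharacters_of_chain {A : Type u} [AddCommGroup A] {L : Type u} [LinearOrder L]
    [WellFoundedLT L] {μ : Cardinal.{u}} (hμ : ℵ₀ ≤ μ) (hpow : (2 : Cardinal.{u}) ^ μ < 2 ^ #L)
    {B : AddSubgroup A} (hB : #B ≤ μ) {N : L → AddSubgroup A} (hN : ∀ α, #(N α) ≤ μ)
    {χ : L → A →+ AddCircle (1 : ℚ)} (hle : ∀ α, B ⊔ ⨆ β : Iio α, N β ≤ N α)
    (hχ : ∀ α, ∀ x ∈ B ⊔ ⨆ β : Iio α, N β, χ α x = 0)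
    (hobs : ∀ α, ∀ ψ : A →+ ℚ, (∀ x ∈ B ⊔ ⨆ β : Iio α, N β, ψ x = 0) →
      ¬ ∀ x ∈ N α, (ψ x : AddCircle (1 : ℚ)) = χ α x) : ¬ LiftsCharacters A := by
  intro hA
  obtain ⟨g, hg⟩ := hA.exists_determined hle
    (fun γ β h => (le_iSup (fun β : Iio γ => N β) ⟨β, h⟩).trans le_sup_right) hχ hobs
  let I := μ.out
  have hI : #I = μ := mk_out μ
  have : Infinite I := by rw [infinite_iff, hI]; exact hμ
  have hcode : ∀ α, Nonempty ((N α → ℚ) ↪ (I → Bool)) := fun α => by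
    rw [← Cardinal.le_def, mk_arrow I, mk_bool, lift_two, lift_uzero, hI]
    exact mk_fun_rat_le hμ (hN α)
  let code := fun α => (hcode α).some
  -- The choice `T η (i :: s)` records at α the i-th bit of a code for the lift of `T η s` on `N α`.
  -- So the values at α of all `T η s` determine all the lifts on `N α`; hence the induction below
  -- treats all lists s at once.
  let T : (L → Bool) → List I → (L → Bool) := fun η s =>
    List.rec η (fun i _ η' α => code α (fun x => g η' x) i) s
  have hT : ∀ η i s α, T η (i :: s) α = code α (fun x => g (T η s) x) i := fun _ _ _ _ => rfl
  have hinj : Function.Injective fun η (q : List I × B) => g (T η q.1) q.2 := by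
    intro η η' h
    have hB' : ∀ s, ∀ x ∈ B, g (T η s) x = g (T η' s) x := fun s x hx =>
      congrFun h (s, ⟨x, hx⟩)
    have key : ∀ α s, T η s α = T η' s α ∧ ∀ x ∈ N α, g (T η s) x = g (T η' s) x := by
      intro α
      induction α using WellFoundedLT.induction with
      | ind α ih =>
        have h1 : ∀ s, T η s α = T η' s α := by
          intro s
          refine hg _ _ α (fun β hβ => (ih β hβ s).1) ?_
          have : B ⊔ ⨆ β : Iio α, N β ≤ (g (T η s)).eqLocus (g (T η' s)) :=
            sup_le (hB' s) (iSup_le fun β => (ih β β.2 s).2)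
          exact this
        refine fun s => ⟨h1 s, ?_⟩
        have : (fun x : N α => g (T η s) x) = fun x : N α => g (T η' s) x := by
          refine (code α).injective (funext fun i => ?_)
          rw [← hT, ← hT]
          exact h1 (i :: s)
        exact fun x hx => congrFun this ⟨x, hx⟩
    exact funext fun α => (key α []).1
  have h1 := mk_le_of_injective hinj
  have h2 : #(List I × B) ≤ μ := by
    rw [mk_prod, lift_id, lift_id, mk_list_eq_mk, hI]
    exact (mul_le_mul_right hB μ).trans (mul_eq_self hμ).le
  have h3 := h1.trans (mk_fun_rat_le hμ h2)
  rw [mk_arrow, mk_bool, lift_two, lift_uzero] at h3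
  exact h3.not_gt hpow

end WhiteheadExt

/-! ### Obstructions from quotients, assembled into a chain. -/

namespace WhiteheadExt

open Cardinal Set

section Chain

variable {A : Type u} [AddCommGroup A] {μ : Cardinal.{u}}

/-- Take N to be the preimage of D and pull back an extension of a non-liftable character. A map ψ
vanishing on P descends to A/P, so it would lift that character on D. -/
theorem exists_obstruction_of_not_liftsCharacters (hμ : ℵ₀ ≤ μ) {P : AddSubgroup A} (hP : #P ≤ μ)
    {D : AddSubgroup (A ⧸ P)} (hD : #D ≤ μ) (hDL : ¬ LiftsCharacters D) :
    ∃ (N : AddSubgroup A) (χ : A →+ AddCircle (1 : ℚ)), #N ≤ μ ∧ P ≤ N ∧ (∀ x ∈ P, χ x = 0) ∧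
      ∀ ψ : A →+ ℚ, (∀ x ∈ P, ψ x = 0) → ¬ ∀ x ∈ N, (ψ x : AddCircle (1 : ℚ)) = χ x := by
  unfold LiftsCharacters at hDL
  push Not at hDL
  obtain ⟨χ₀, hχ₀⟩ := hDL
  obtain ⟨χ₁, hχ₁⟩ := exists_addMonoidHom_extension (f := D.subtype) D.subtype_injective χ₀
  refine ⟨D.comap (QuotientAddGroup.mk' P), χ₁.comp (QuotientAddGroup.mk' P), ?_, ?_, ?_, ?_⟩
  · have hmem : ∀ n : D.comap (QuotientAddGroup.mk' P),
        (n : A) - Quotient.out (n : A ⧸ P) ∈ P := fun n => by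
      rw [← QuotientAddGroup.eq_zero_iff, QuotientAddGroup.mk_sub, sub_eq_zero]
      exact (Quotient.out_eq' _).symm
    let j : D.comap (QuotientAddGroup.mk' P) → D × P := fun n => (⟨(n : A ⧸ P), n.2⟩, ⟨_, hmem n⟩)
    have hj : Function.Injective j := by
      intro n n' h
      have h1 : ((n : A) : A ⧸ P) = (n' : A) := congrArg (fun p => (p.1 : A ⧸ P)) h
      have h2 : (n : A) - Quotient.out (n : A ⧸ P) = n' - Quotient.out (n' : A ⧸ P) :=
        congrArg (fun p => (p.2 : A)) h
      rw [h1] at h2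
      exact Subtype.ext (sub_left_injective h2)
    refine (mk_le_of_injective hj).trans ?_
    rw [mk_prod, lift_id, lift_id]
    exact (mul_le_mul' hD hP).trans (mul_eq_self hμ).le
  · intro x hx
    have : (x : A ⧸ P) = 0 := (QuotientAddGroup.eq_zero_iff x).2 hx
    change (x : A ⧸ P) ∈ D
    rw [this]
    exact D.zero_mem
  · intro x hx
    have : (x : A ⧸ P) = 0 := (QuotientAddGroup.eq_zero_iff x).2 hx
    change χ₁ (x : A ⧸ P) = 0
    rw [this, map_zero]
  · intro ψ hψ h
    obtain ⟨d, hd⟩ := hχ₀ ((QuotientAddGroup.lift P ψ hψ).comp D.subtype)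
    obtain ⟨⟨x⟩, hx⟩ := d
    exact hd ((h x hx).trans (hχ₁ ⟨_, hx⟩))

/-- If all quotients of `A` by subgroups of cardinality `μ` above `B` contain subgroups of
cardinality `μ` with homomorphisms to `ℚ / ℤ` that do not lift to `ℚ`, then `A` has such a
homomorphism too. -/
theorem not_liftsCharacters_of_quotients (hμ : ℵ₀ ≤ μ)
    (hpow : (2 : Cardinal.{u}) ^ μ < 2 ^ Order.succ μ) {B : AddSubgroup A} (hB : #B ≤ μ)
    (hquot : ∀ P : AddSubgroup A, B ≤ P → #P ≤ μ →
      ∃ D : AddSubgroup (A ⧸ P), #D ≤ μ ∧ ¬ LiftsCharacters D) : ¬ LiftsCharacters A := by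
  have hex : ∀ P : AddSubgroup A, ∃ (N : AddSubgroup A) (χ : A →+ AddCircle (1 : ℚ)),
      B ≤ P → #P ≤ μ → #N ≤ μ ∧ P ≤ N ∧ (∀ x ∈ P, χ x = 0) ∧
        ∀ ψ : A →+ ℚ, (∀ x ∈ P, ψ x = 0) → ¬ ∀ x ∈ N, (ψ x : AddCircle (1 : ℚ)) = χ x := by
    intro P
    by_cases h : B ≤ P ∧ #P ≤ μ
    · obtain ⟨D, hD, hDL⟩ := hquot P h.1 h.2
      obtain ⟨N, χ, h'⟩ := exists_obstruction_of_not_liftsCharacters hμ h.2 hD hDL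
      exact ⟨N, χ, fun _ _ => h'⟩
    -- Nothing is required when P is too large or does not contain B; such P do not occur in the
    -- chain.
    · exact ⟨⊥, 0, fun h1 h2 => (h ⟨h1, h2⟩).elim⟩
  choose nxt χ hnxt using hex
  let L := (Order.succ μ).ord.ToType
  have hL : #L = Order.succ μ := mk_ord_toType _
  have hIio : ∀ α : L, #(Iio α) < Order.succ μ := fun α => by
    simpa only [hL] using mk_Iio_lt α (by rw [hL, Ordinal.type_toType])
  let N : L → AddSubgroup A := wellFounded_lt.fix fun α F => nxt (B ⊔ ⨆ β : Iio α, F β β.2)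
  have hN : ∀ α, N α = nxt (B ⊔ ⨆ β : Iio α, N β) := fun α => wellFounded_lt.fix_eq _ _
  have hcard : ∀ α, #(N α) ≤ μ ∧ #(B ⊔ ⨆ β : Iio α, N β : AddSubgroup A) ≤ μ := by
    intro α
    induction α using WellFoundedLT.induction with
    | ind α ih =>
      have h1 : #(B ⊔ ⨆ β : Iio α, N β : AddSubgroup A) ≤ μ := by
        have hcl : B ⊔ ⨆ β : Iio α, N β =
            AddSubgroup.closure ((B : Set A) ∪ ⋃ β : Iio α, (N β : Set A)) := by
          simp only [AddSubgroup.closure_union, AddSubgroup.closure_iUnion, AddSubgroup.closure_eq]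
        rw [hcl]
        refine (mk_addSubgroup_closure_le _).trans (max_le ?_ hμ)
        refine (mk_union_le _ _).trans (add_le_of_le hμ hB ?_)
        refine (mk_iUnion_le _).trans ?_
        refine (mul_le_mul' (Order.lt_succ_iff.1 (hIio α))
          (ciSup_le' fun β : Iio α => (ih β β.2).1)).trans (mul_eq_self hμ).le
      refine ⟨?_, h1⟩
      rw [hN]
      exact (hnxt _ le_sup_left h1).1
  refine not_liftsCharacters_of_chain hμ (L := L) (by rwa [hL]) hB (fun α => (hcard α).1)
    (χ := fun α => χ (B ⊔ ⨆ β : Iio α, N β)) (fun α => ?_) (fun α => ?_) (fun α => ?_)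
  · rw [hN α]
    exact (hnxt _ le_sup_left (hcard α).2).2.1
  · exact (hnxt _ le_sup_left (hcard α).2).2.2.1
  · rw [hN α]
    exact (hnxt _ le_sup_left (hcard α).2).2.2.2

end Chain

/-! ### Solvability modulo subgroups against unsolvability over ℤ. -/

section Solvable

open Classical in
/-- All systems of equations `2 y_{ν,n+1} - y_{ν,n} - z_{ζ_ν(n)} = a_{ν,n}` are solvable
modulo `B`, where the terms `z_{ζ_ν(n)}` are omitted if `μ` is countable. -/
def SolvesMod (μ : Cardinal.{u}) (E : Set Ordinal.{u}) (ζ : Ordinal.{u} → ℕ → Ordinal.{u})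
    {A : Type u} [AddCommGroup A] (B : AddSubgroup A) : Prop :=
  ∀ a : Ordinal.{u} → ℕ → A, ∃ (y : Ordinal.{u} → ℕ → A) (z : Ordinal.{u} → A),
    ∀ ν ∈ E, ∀ n, 2 • y ν (n + 1) - y ν n - (if ℵ₀ < μ then z (ζ ν n) else 0) - a ν n ∈ B

open Classical in
/-- Coefficients for which the systems of equations have no integer solutions. -/
def IsUnsolvable (μ : Cardinal.{u}) (E : Set Ordinal.{u}) (ζ : Ordinal.{u} → ℕ → Ordinal.{u})
    (ε : Ordinal.{u} → ℕ → ℤ) : Prop :=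
  ∀ z : Ordinal.{u} → ℤ, ∃ ν ∈ E, ∀ m : ℤ, m ≠ 0 → ∀ y : ℕ → ℤ,
    ¬ ∀ n, 2 * y (n + 1) - y n = (if ℵ₀ < μ then z (ζ ν n) else 0) + ε ν n * m

variable {μ : Cardinal.{u}} {E : Set Ordinal.{u}} {ζ : Ordinal.{u} → ℕ → Ordinal.{u}}

theorem Diamond.exists_isUnsolvable (h : Diamond μ E) (hμ : μ.IsRegular) (hμ' : ℵ₀ < μ)
    (hζ : ∀ ν ∈ E, ∀ n, ζ ν n < ν) : ∃ ε, IsUnsolvable μ E ζ ε := by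
  obtain ⟨G, hG⟩ := h.exists_guess hμ hμ'
  choose ε hε using fun ν => exists_unsolvable fun n => G ν (ζ ν n)
  refine ⟨ε, fun z => ?_⟩
  obtain ⟨ν, hν, hz⟩ := hG z
  refine ⟨ν, hν, fun m hm y hy => hε ν m hm y fun n => ?_⟩
  rw [hy n, if_pos hμ', hz _ (hζ ν hν n)]

theorem exists_isUnsolvable_of_countable (hμ : ¬ ℵ₀ < μ) (hE : E.Nonempty) :
    ∃ ε, IsUnsolvable μ E ζ ε := by
  obtain ⟨ε, hε⟩ := exists_unsolvable 0
  obtain ⟨ν, hν⟩ := hE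
  refine ⟨fun _ => ε, fun z => ⟨ν, hν, fun m hm y hy => hε m hm y fun n => ?_⟩⟩
  rw [hy n, if_neg hμ, Pi.zero_apply]

/-- Outside the 6-divisible case, D is generated by some g ∉ 6(A/P) and a solution for the
right-hand sides ε·g. If D lifted characters, some φ : D → ℤ with m = φ(g) ≠ 0 would map this to an
integer solution ruled out by ε. -/
theorem SolvesMod.exists_not_liftsCharacters {A : Type u} [AddCommGroup A] {P : AddSubgroup A}
    (h : SolvesMod μ E ζ P) (hμ : ℵ₀ ≤ μ) (hE : E ⊆ Iio μ.ord) {ε : Ordinal.{u} → ℕ → ℤ}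
    (hε : IsUnsolvable μ E ζ ε) [Nontrivial (A ⧸ P)] :
    ∃ D : AddSubgroup (A ⧸ P), #D ≤ μ ∧ ¬ LiftsCharacters D := by
  classical
  by_cases hdiv : ∀ c : A ⧸ P, ∃ d, 6 • d = c
  · obtain ⟨D, hD, hDL⟩ := exists_countable_not_liftsCharacters_of_divisible hdiv
    exact ⟨D, (mk_le_aleph0_iff.2 hD).trans hμ, hDL⟩
  push Not at hdiv
  obtain ⟨g, hg⟩ := hdiv
  obtain ⟨g', rfl⟩ := QuotientAddGroup.mk_surjective g
  obtain ⟨y, z, hyz⟩ := h fun ν n => ε ν n • g'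
  let s : Set (A ⧸ P) := range (fun p : E × ℕ => (y p.1 p.2 : A ⧸ P)) ∪
    (range (fun p : E × ℕ => (z (ζ p.1 p.2) : A ⧸ P)) ∪ {(g' : A ⧸ P)})
  let D := AddSubgroup.closure s
  have hEcard : #(E × ℕ) ≤ Cardinal.lift.{u + 1} μ := by
    have h1 : #E ≤ Cardinal.lift.{u + 1} μ := by
      refine (mk_le_mk_of_subset hE).trans ?_
      rw [mk_Iio_ordinal, card_ord]
    have h2 : ℵ₀ ≤ Cardinal.lift.{u + 1} μ := aleph0_le_lift.2 hμ
    rw [mk_prod, lift_uzero, mk_nat, lift_aleph0]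
    exact (mul_le_mul' h1 h2).trans (mul_eq_self h2).le
  have hrange : ∀ f : E × ℕ → A ⧸ P, #(range f) ≤ μ := fun f => by
    have h1 := mk_range_le_lift (f := f)
    rw [lift_id'.{u, u + 1}] at h1
    exact Cardinal.lift_le.{u + 1}.1 (h1.trans hEcard)
  have hs : #s ≤ μ := by
    refine (mk_union_le _ _).trans (add_le_of_le hμ (hrange _) ?_)
    refine (mk_union_le _ _).trans (add_le_of_le hμ (hrange _) ?_)
    rw [mk_singleton]
    exact one_le_aleph0.trans hμ
  refine ⟨D, (mk_addSubgroup_closure_le s).trans (max_le hs hμ), fun hD => ?_⟩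
  have hyD : ∀ ν ∈ E, ∀ n, (y ν n : A ⧸ P) ∈ D := fun ν hν n =>
    AddSubgroup.subset_closure (Or.inl ⟨(⟨ν, hν⟩, n), rfl⟩)
  have hzD : ∀ ν ∈ E, ∀ n, (z (ζ ν n) : A ⧸ P) ∈ D := fun ν hν n =>
    AddSubgroup.subset_closure (Or.inr (Or.inl ⟨(⟨ν, hν⟩, n), rfl⟩))
  have hgD : (g' : A ⧸ P) ∈ D := AddSubgroup.subset_closure (Or.inr (Or.inr rfl))
  obtain ⟨φ, hφ⟩ := hD.exists_hom_int (n := 6) (by norm_num) (g := ⟨_, hgD⟩)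
    fun d hd => hg d (congrArg Subtype.val hd)
  -- The value 0 for z_j outside D is harmless: only z_{ζ_ν(n)} with ν ∈ E enter the equations, and
  -- these lie in D.
  obtain ⟨ν, hν, hno⟩ := hε fun j => if hj : (z j : A ⧸ P) ∈ D then φ ⟨_, hj⟩ else 0
  refine hno _ hφ (fun n => φ ⟨_, hyD ν hν n⟩) fun n => ?_
  have heq : (2 : ℤ) • (⟨_, hyD ν hν (n + 1)⟩ : D) - ⟨_, hyD ν hν n⟩ =
      (if ℵ₀ < μ then ⟨_, hzD ν hν n⟩ else 0) + ε ν n • ⟨_, hgD⟩ := by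
    have := (QuotientAddGroup.eq_zero_iff _).2 (hyz ν hν n)
    apply Subtype.ext
    split_ifs with hμ'
    · simp only [if_pos hμ'] at this
      rw [QuotientAddGroup.mk_sub, QuotientAddGroup.mk_sub, QuotientAddGroup.mk_sub,
        QuotientAddGroup.mk_nsmul, QuotientAddGroup.mk_zsmul, sub_eq_zero, sub_eq_iff_eq_add] at this
      push_cast
      rw [ofNat_zsmul, this, add_comm]
    · simp only [if_neg hμ', sub_zero] at this
      rw [QuotientAddGroup.mk_sub, QuotientAddGroup.mk_sub, QuotientAddGroup.mk_nsmul,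
        QuotientAddGroup.mk_zsmul, sub_eq_zero] at this
      push_cast
      rw [zero_add, ← this, ofNat_zsmul]
  have := congrArg φ heq
  rw [map_sub, map_add, map_zsmul, map_zsmul] at this
  rw [dif_pos (hzD ν hν n)]
  simp only [smul_eq_mul] at this
  rw [this]
  split_ifs <;> simp

end Solvable

end WhiteheadExt

/-! ### The presentation of H and the resulting equations in A. -/

namespace WhiteheadExt

open Cardinal Set

section Presentation

variable {μ : Cardinal.{u}} {S E : Set Ordinal.{u}} {η : Ordinal.{u} → Ordinal.{u} → Ordinal.{u}}
  {ζ : Ordinal.{u} → ℕ → Ordinal.{u}}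

theorem w_apply_y_zero (δ ν δ' ν' : Ordinal.{u}) (n : ℕ) :
    w μ η ζ δ ν n (Sym.y δ' ν' 0) = - if (δ, ν, n) = (δ', ν', 0) then 1 else 0 := by
  classical
  unfold w
  split_ifs <;> simp_all

theorem w_apply_y_succ (δ ν δ' ν' : Ordinal.{u}) (n k : ℕ) :
    w μ η ζ δ ν n (Sym.y δ' ν' (k + 1)) =
      2 * (if (δ, ν, n) = (δ', ν', k) then 1 else 0) -
        if (δ, ν, n) = (δ', ν', k + 1) then 1 else 0 := by
  classical
  unfold w
  split_ifs <;> simp_all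

variable (μ η ζ) in
-- The coefficient of a combination l at y_{δ,ν,0} is -l(δ,ν,0), and at y_{δ,ν,k+1} it is 2l(δ,ν,k)
-- - l(δ,ν,k+1), so l vanishes by induction. Independence allows arbitrary values to be prescribed
-- on the w's.
theorem linearIndependent_w : LinearIndependent ℤ
    fun p : Ordinal.{u} × Ordinal.{u} × ℕ => w μ η ζ p.1 p.2.1 p.2.2 := by
  classical
  rw [linearIndependent_iff]
  intro l hl
  have h0 : ∀ δ ν, Finsupp.linearCombination ℤ
      (fun p : Ordinal.{u} × Ordinal.{u} × ℕ => w μ η ζ p.1 p.2.1 p.2.2) l (Sym.y δ ν 0) =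
        - l (δ, ν, 0) := by
    intro δ ν
    clear hl
    induction l using Finsupp.induction_linear with
    | zero => simp
    | add f g hf hg => rw [map_add, Finsupp.add_apply, hf, hg, Finsupp.add_apply]; ring
    | single p c =>
      rw [Finsupp.linearCombination_single, Finsupp.smul_apply, w_apply_y_zero,
        Finsupp.single_apply]
      split_ifs <;> simp_all
  have hs : ∀ δ ν k, Finsupp.linearCombination ℤ
      (fun p : Ordinal.{u} × Ordinal.{u} × ℕ => w μ η ζ p.1 p.2.1 p.2.2) l (Sym.y δ ν (k + 1)) =
        2 * l (δ, ν, k) - l (δ, ν, k + 1) := by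
    intro δ ν k
    clear hl h0
    induction l using Finsupp.induction_linear with
    | zero => simp
    | add f g hf hg =>
      rw [map_add, Finsupp.add_apply, hf, hg, Finsupp.add_apply, Finsupp.add_apply]; ring
    | single p c =>
      rw [Finsupp.linearCombination_single, Finsupp.smul_apply, w_apply_y_succ,
        Finsupp.single_apply, Finsupp.single_apply, smul_eq_mul]
      split_ifs <;> simp_all [mul_comm]
  ext ⟨δ, ν, n⟩
  rw [Finsupp.zero_apply]
  induction n with
  | zero =>
    have := h0 δ ν
    rw [hl, Finsupp.zero_apply] at this
    linarith
  | succ n ih =>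
    have := hs δ ν n
    rw [hl, Finsupp.zero_apply, ih] at this
    linarith

/-- The symbols live one universe higher than H and A; smallness of F lets it enter an Ext sequence
with them. -/
theorem small_F (hS : S ⊆ Iio (Order.succ μ).ord) (hE : E ⊆ Iio μ.ord) :
    Small.{u} (F μ S E) := by
  have : Small.{u} S := small_subset hS
  have : Small.{u} E := small_subset hE
  let f : (S × E × ℕ) ⊕ (S × Iio μ.ord.cof.ord) ⊕ Iio (Order.succ μ).ord → Sym.{u} :=
    Sum.elim (fun p => Sym.y p.1 p.2.1 p.2.2) (Sum.elim (fun p => Sym.z p.1 p.2) fun b => Sym.x b)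
  have hf : symbols μ S E ⊆ range f := by
    rintro s (⟨δ, hδ, ν, hν, n, rfl⟩ | ⟨-, δ, hδ, j, hj, rfl⟩ | ⟨β, hβ, rfl⟩)
    · exact ⟨Sum.inl (⟨δ, hδ⟩, ⟨ν, hν⟩, n), rfl⟩
    · exact ⟨Sum.inr (Sum.inl (⟨δ, hδ⟩, ⟨j, hj⟩)), rfl⟩
    · exact ⟨Sum.inr (Sum.inr ⟨β, hβ⟩), rfl⟩
  have : Small.{u} (symbols μ S E) := small_subset hf
  refine small_of_injective (β := symbols μ S E → ℤ)
    (f := fun v s => (v : Sym.{u} →₀ ℤ) s) fun v v' h => Subtype.ext (Finsupp.ext fun s => ?_)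
  by_cases hs : s ∈ symbols μ S E
  · exact congrFun h ⟨s, hs⟩
  · rw [(Finsupp.mem_supported' ℤ _).1 v.2 s hs, (Finsupp.mem_supported' ℤ _).1 v'.2 s hs]

open Classical in
/-- If `Ext(H, A) = 0`, then the equations defining `H` are solvable in `A` with arbitrary right
hand sides. -/
theorem IsBuiltOn.exists_solution {H A : Type u} [AddCommGroup H] [AddCommGroup A]
    (hμ : μ.IsRegular) (hE : E ⊆ Iio μ.ord) (hH : IsBuiltOn μ S η E ζ H)
    (hext : Subsingleton (ExtOne H A)) (a : Ordinal.{u} → Ordinal.{u} → ℕ → A) :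
    ∃ (y : Ordinal.{u} → Ordinal.{u} → ℕ → A) (z : Ordinal.{u} → Ordinal.{u} → A)
      (x : Ordinal.{u} → A), ∀ δ ∈ S, ∀ ν ∈ E, ∀ n, ∃ β < δ,
        2 • y δ ν (n + 1) - y δ ν n - (if ℵ₀ < μ then z δ (ζ ν n) else 0) + x β = a δ ν n := by
  have hcof := hμ.cof_ord
  obtain ⟨⟨hS, -, -, hη, -, -, -, -, hζ⟩, ⟨e⟩⟩ := hH
  have hη' : ∀ δ ∈ S, ∀ ν ∈ E, ∀ n : ℕ, η δ (ν + n) < δ := fun δ hδ ν hν n => by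
    refine hη.lt δ hδ _ ?_
    rw [hcof, mem_Iio, lt_ord, Ordinal.card_add, Ordinal.card_nat]
    exact add_lt_of_lt hμ.aleph0_le (lt_ord.1 (hE hν)) (natCast_lt_aleph0.trans_le hμ.aleph0_le)
  have hw : ∀ δ ∈ S, ∀ ν ∈ E, ∀ n, w μ η ζ δ ν n ∈ F μ S E := by
    intro δ hδ ν hν n
    have hy : ∀ n, Finsupp.single (Sym.y δ ν n) (1 : ℤ) ∈ F μ S E := fun n =>
      Finsupp.single_mem_supported ℤ _ (Or.inl ⟨δ, hδ, ν, hν, n, rfl⟩)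
    refine add_mem (sub_mem (sub_mem ((F μ S E).smul_mem _ (hy _)) (hy _)) ?_)
      (Finsupp.single_mem_supported ℤ _ (Or.inr (Or.inr
        ⟨_, (hη' δ hδ ν hν n).trans (hS hδ), rfl⟩)))
    split_ifs with h
    · refine Finsupp.single_mem_supported ℤ _ (Or.inr (Or.inl ⟨h, δ, hδ, _, ?_, rfl⟩))
      rw [hcof]
      exact ((hζ h).lt ν hν n (mem_univ n)).trans (hE hν)
    · exact zero_mem _
  have hK : K μ S η E ζ ≤ Submodule.span ℤ (range fun p : Ordinal.{u} × Ordinal.{u} × ℕ =>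
      w μ η ζ p.1 p.2.1 p.2.2) := by
    refine Submodule.span_mono ?_
    rintro _ ⟨δ, -, ν, -, n, rfl⟩
    exact ⟨(δ, ν, n), rfl⟩
  have hli := linearIndependent_w μ η ζ
  let f := ((Module.Basis.span hli).constr ℤ fun p => a p.1 p.2.1 p.2.2)
  have hf : ∀ δ ν n h, f ⟨w μ η ζ δ ν n, h⟩ = a δ ν n := fun δ ν n h => by
    have h1 := (Module.Basis.span hli).constr_basis ℤ (fun p => a p.1 p.2.1 p.2.2) (δ, ν, n)
    rw [← h1]
    congr 1
    exact (Module.Basis.span_apply hli (δ, ν, n)).symm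
  let r : (K μ S η E ζ).submoduleOf (F μ S E) →ₗ[ℤ] K μ S η E ζ :=
    ((F μ S E).subtype.comp (Submodule.subtype _)).codRestrict _ fun v => v.2
  have := small_F (μ := μ) hS hE
  obtain ⟨g, hg⟩ := exists_extension_of_subsingleton_extOne_of_small _ e hext
    (f ∘ₗ Submodule.inclusion hK ∘ₗ r)
  let G : (Sym.{u} →₀ ℤ) →ₗ[ℤ] A := g ∘ₗ Finsupp.restrictDom ℤ ℤ (symbols μ S E)
  have hG : ∀ v, ∀ hv : v ∈ F μ S E, G v = g ⟨v, hv⟩ := fun v hv => by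
    have := LinearMap.congr_fun (Finsupp.restrictDom_comp_subtype (R := ℤ) (M := ℤ)
      (symbols μ S E)) ⟨v, hv⟩
    exact congrArg g this
  refine ⟨fun δ ν n => G (Finsupp.single (Sym.y δ ν n) 1),
    fun δ j => G (Finsupp.single (Sym.z δ j) 1), fun β => G (Finsupp.single (Sym.x β) 1),
    fun δ hδ ν hν n => ⟨_, hη' δ hδ ν hν n, ?_⟩⟩
  have hwK : w μ η ζ δ ν n ∈ K μ S η E ζ := Submodule.subset_span ⟨δ, hδ, ν, hν, n, rfl⟩
  have h1 : G (w μ η ζ δ ν n) = a δ ν n := by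
    rw [hG _ (hw δ hδ ν hν n)]
    exact (hg ⟨⟨_, hw δ hδ ν hν n⟩, hwK⟩).trans (hf δ ν n _)
  rw [← h1, w, hcof, map_add, map_sub, map_sub, map_zsmul, ofNat_zsmul, apply_ite G, map_zero]

end Presentation

/-! ### Diagonalizing over the stationary set S, and the conclusion. -/

theorem two_power_lt_of_GCH (h : GCH.{u}) {μ : Cardinal.{u}} (hμ : ℵ₀ ≤ μ) :
    (2 : Cardinal.{u}) ^ μ < 2 ^ Order.succ μ := by
  rw [h μ hμ]
  exact cantor _

theorem exists_injective_lt_ord {A : Type u} {κ : Cardinal.{u}} (hA : #A = κ) :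
    ∃ idx : A → Ordinal.{u}, Function.Injective idx ∧ ∀ a, idx a < κ.ord := by
  have : #A = #κ.ord.ToType := by rw [hA, mk_ord_toType]
  obtain ⟨e⟩ := Cardinal.eq.1 this
  exact ⟨fun a => (Ordinal.ToType.mk.symm (e a) : Iio κ.ord),
    Subtype.val_injective.comp (Ordinal.ToType.mk.symm.injective.comp e.injective),
    fun a => (Ordinal.ToType.mk.symm (e a) : Iio κ.ord).2⟩

theorem exists_solvesMod
    {μ : Cardinal.{u}} (hμ : μ.IsRegular) {S E : Set Ordinal.{u}}
    {η : Ordinal.{u} → Ordinal.{u} → Ordinal.{u}} {ζ : Ordinal.{u} → ℕ → Ordinal.{u}}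
    (hE : E ⊆ Iio μ.ord) {H A : Type u} [AddCommGroup H] [AddCommGroup A]
    (hH : IsBuiltOn μ S η E ζ H) (hext : Subsingleton (ExtOne H A)) (hcard : #A = Order.succ μ) :
    ∃ B : AddSubgroup A, #B ≤ μ ∧ SolvesMod μ E ζ B := by
  classical
  obtain ⟨idx, hidx, hlt⟩ := exists_injective_lt_ord hcard
  let B : Ordinal.{u} → AddSubgroup A := fun δ => AddSubgroup.closure {a | idx a < δ}
  have hB : ∀ δ < (Order.succ μ).ord, #(B δ) ≤ μ := by
    intro δ hδ
    refine (mk_addSubgroup_closure_le _).trans (max_le ?_ hμ.aleph0_le)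
    have h1 : Cardinal.lift.{u + 1} #{a | idx a < δ} ≤ Cardinal.lift.{u} #(Iio δ) :=
      lift_mk_le_lift_mk_of_injective (f := fun a : {a | idx a < δ} => (⟨idx a, a.2⟩ : Iio δ))
        fun a a' h => Subtype.ext (hidx (congrArg Subtype.val h))
    rw [mk_Iio_ordinal, lift_id'.{u, u + 1}, Cardinal.lift_le] at h1
    exact h1.trans (Order.lt_succ_iff.1 (lt_ord.1 hδ))
  by_contra! hno
  have hbad : ∀ δ, ∃ a : Ordinal.{u} → ℕ → A, δ < (Order.succ μ).ord →
      ¬ ∃ (y : Ordinal.{u} → ℕ → A) (z : Ordinal.{u} → A), ∀ ν ∈ E, ∀ n,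
        2 • y ν (n + 1) - y ν n - (if ℵ₀ < μ then z (ζ ν n) else 0) - a ν n ∈ B δ := by
    intro δ
    by_cases hδ : δ < (Order.succ μ).ord
    · have := hno (B δ) (hB δ hδ)
      unfold SolvesMod at this
      obtain ⟨a, ha⟩ := not_forall.1 this
      exact ⟨a, fun _ => ha⟩
    · exact ⟨0, fun h => (hδ h).elim⟩
  choose a ha using hbad
  obtain ⟨y, z, x, hsol⟩ := hH.exists_solution hμ hE hext a
  -- One family x serves all δ. At a closure point δ ∈ S of β ↦ `idx (x β)`, every x β with β < δ
  -- lies in `B δ`, so the x-terms disappear modulo `B δ`.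
  obtain ⟨δ, hδS, hδ, hcl⟩ := hH.ladders.S_stationary.exists_closed_under
    (isRegular_succ hμ.aleph0_le) (Order.lt_succ_of_le hμ.aleph0_le) (fun β => idx (x β))
    fun β _ => hlt _
  refine ha δ hδ ⟨y δ, z δ, fun ν hν n => ?_⟩
  obtain ⟨β, hβ, h⟩ := hsol δ hδS ν hν n
  rw [← h, sub_add_cancel_left]
  exact neg_mem (AddSubgroup.subset_closure (hcl β hβ))

end WhiteheadExt

theorem mainTheorem7 (hGCH : WhiteheadExt.GCH.{u})
    (μ : Cardinal.{u}) (hμ : μ.IsRegular)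
    (S E : Set Ordinal.{u})
    (η : Ordinal.{u} → Ordinal.{u} → Ordinal.{u}) (ζ : Ordinal.{u} → ℕ → Ordinal.{u})
    (hE : Cardinal.aleph0 < μ → ∀ E' : Set Ordinal.{u}, E' ⊆ E →
      WhiteheadExt.IsStationaryIn μ E' → WhiteheadExt.Diamond μ E')
    (H : Type u) [AddCommGroup H] (hH : WhiteheadExt.IsBuiltOn μ S η E ζ H)
    (A : Type u) [AddCommGroup A] (hA : WhiteheadExt.IsWhitehead A)
    (hcard : Cardinal.mk A = Order.succ μ) :
    Nontrivial (WhiteheadExt.ExtOne H A) := by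
  open WhiteheadExt Cardinal Set in
  by_contra hext
  rw [not_nontrivial_iff_subsingleton] at hext
  have hcof := hμ.cof_ord
  have hE0 : ¬ ℵ₀ < μ → E = {0} := fun h =>
    hH.ladders.E_countable (hcof.trans (hμ.aleph0_le.antisymm (not_lt.1 h)).symm)
  have hEsub : E ⊆ Iio μ.ord := by
    by_cases h : ℵ₀ < μ
    · have := hH.ladders.E_subset (by rwa [hcof])
      rwa [hcof] at this
    · rw [hE0 h]
      exact singleton_subset_iff.2 hμ.ord_pos
  have hε : ∃ ε, IsUnsolvable μ E ζ ε := by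
    by_cases h : ℵ₀ < μ
    · have hstat := hH.ladders.E_stationary (by rwa [hcof])
      rw [hcof] at hstat
      exact (hE h E subset_rfl hstat).exists_isUnsolvable hμ h fun ν hν n =>
        (hH.ladders.ladder_ζ (by rwa [hcof])).lt ν hν n (mem_univ n)
    · exact exists_isUnsolvable_of_countable h (by rw [hE0 h]; exact singleton_nonempty 0)
  obtain ⟨ε, hε⟩ := hε
  obtain ⟨B, hB, hsolv⟩ := exists_solvesMod hμ hEsub hH hext hcard
  refine not_liftsCharacters_of_quotients hμ.aleph0_le (two_power_lt_of_GCH hGCH hμ.aleph0_le) hB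
    (fun P hBP hP => ?_) hA.liftsCharacters
  have hsolvP : SolvesMod μ E ζ P := fun a => by
    obtain ⟨y, z, h⟩ := hsolv a
    exact ⟨y, z, fun ν hν n => hBP (h ν hν n)⟩
  have : Nontrivial (A ⧸ P) := by
    refine QuotientAddGroup.nontrivial_iff.2 ?_
    rintro rfl
    have h1 : #(⊤ : AddSubgroup A) = #A := mk_congr (Equiv.Set.univ A)
    rw [h1, hcard] at hP
    exact (Order.lt_succ μ).not_ge hP
  exact hsolvP.exists_not_liftsCharacters hμ.aleph0_le hEsub hε
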